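/- Distribution estimation under communication constraints. There is a universal constant $C>0$ such that the following holds for all integers $n\ge 0$, $k\ge 0$ and $d\ge 1$ with $n\min\{2^k,d\}\ge d^2$ (so that in fact $n\ge1$). Let $\mathcal X=\{1,\dots,d+1\}$, let $\Theta=\{\theta\in[0,1]^{d+1}:\sum_x\theta_x=1\}$ be the probability simplex, and let $X_1,\dots,X_n$ be i.i.d. with $\mathbb P_\theta(X_i=x)=\theta_x$, where $X_i$ is held by node $i$. Let the samples be communicated by a protocol of one of the following three types. (1) Independent: node $i$ sends a message $M_i\in[2^k]$ drawn, independently of the other nodes, from a conditional law $p_i(m_i\mid x_i)$, and the transcript is $Y=(M_1,\dots,M_n)$. (2) Sequential: for $i=1,\dots,n$ in this order, node $i$ sends a message $M_i\in[2^k]$ drawn from a conditional law $p_i(m_i\mid x_i;m_1,\dots,m_{i-1})$, and the transcript is $Y=(M_1,\dots,M_n)$. (3) Blackboard: a complete binary tree of depth $nk$ is given. Each internal node $v$ of the tree carries a label $l_v\in\{1,\dots,n\}$ and a function $b_v:\mathcal X\to[0,1]$, and for each $i$ every root-to-leaf path has exactly $k$ internal nodes with label $i$. Starting from the root, when the protocol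 is at $v$, node $l_v$ writes the bit $1$ with probability $b_v(X_{l_v})$ and $0$ otherwise, and the protocol moves to the corresponding child of $v$. The transcript $Y\in\{0,1\}^{nk}$ is the sequence of written bits. Then for every such protocol and every estimator $\hat\theta=\hat\theta(Y)$ with values in $\mathbb R^{d+1}$, $$\sup_{\theta\in\Theta}\mathbb E_\theta\|\hat\theta(Y)-\theta\|_2^2\;\ge\;C\max\left\{\frac{d}{n2^k},\frac1n\right\}.$$ -/

import Mathlib

/-- The probability that `n` i.i.d. samples from the distribution `θ` on `{0, …, d}` (that is, with
`f(x | θ) = θ_x`) are equal to `x 0, …, x (n - 1)`. -/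
noncomputable def sampleProb {n d : ℕ} (θ : stdSimplex ℝ (Fin (d + 1)))
    (x : Fin n → Fin (d + 1)) : ℝ :=
  ∏ i, θ.1 (x i)

/-- Independent protocol: node `i` sends a `k`-bit message, drawn from the conditional law
`quantizer i x` (that is, `p(m | x) = quantizer i x m`) when its sample is `x`. -/
structure IndProtocol (n k : ℕ) (X : Type) where
  quantizer : Fin n → X → stdSimplex ℝ (Fin (2 ^ k))

/-- Conditional probability of the messages `m` given the samples `x`. -/
noncomputable def IndProtocol.condProb {n k : ℕ} {X : Type} (P : IndProtocol n k X)
    (x : Fin n → X) (m : Fin n → Fin (2 ^ k)) : ℝ :=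
  ∏ i, (P.quantizer i (x i)).1 (m i)

/-- Sequential protocol: the conditional law of the `k`-bit message of node `i` may also depend on
the messages of the nodes `0, …, i - 1`. -/
structure SeqProtocol (n k : ℕ) (X : Type) where
  quantizer : (i : Fin n) → (Fin i → Fin (2 ^ k)) → X → stdSimplex ℝ (Fin (2 ^ k))

/-- Conditional probability of the messages `m` given the samples `x`. -/
noncomputable def SeqProtocol.condProb {n k : ℕ} {X : Type} (P : SeqProtocol n k X)
    (x : Fin n → X) (m : Fin n → Fin (2 ^ k)) : ℝ :=
  ∏ i, (P.quantizer i (Fin.take i i.isLt.le m) (x i)).1 (m i)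

/-- Blackboard protocol: a binary tree of depth `n * k`. An internal node of the tree at depth `t`
is given by the `t` bits that lead to it from the root. `label` names the node of the network that
writes the next bit, `bitProb` is the probability that this bit is `1` as a function of the
sample held by the writer. Every root-to-leaf path has exactly `k` internal nodes with label `i`,
for each `i`. -/
structure BlackboardProtocol (n k : ℕ) (X : Type) where
  label : (t : Fin (n * k)) → (Fin t → Bool) → Fin n
  bitProb : (t : Fin (n * k)) → (Fin t → Bool) → X → unitInterval
  card_label : ∀ (y : Fin (n * k) → Bool) (i : Fin n),
    (Finset.univ.filter fun t : Fin (n * k) => label t (Fin.take t t.isLt.le y) = i).card = k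

/-- Conditional probability of the transcript `y` given the samples `x`. -/
noncomputable def BlackboardProtocol.condProb {n k : ℕ} {X : Type} (P : BlackboardProtocol n k X)
    (x : Fin n → X) (y : Fin (n * k) → Bool) : ℝ :=
  ∏ t : Fin (n * k),
    let v := Fin.take t t.isLt.le y
    let b : ℝ := P.bitProb t v (x (P.label t v))
    if y t then b else 1 - b

/-- Probability of the transcript `y` when the samples are i.i.d. from `θ` and the transcript has
the conditional law `W x` given the samples `x`. -/
noncomputable def transcriptProb {n d : ℕ} {Y : Type} (W : (Fin n → Fin (d + 1)) → Y → ℝ)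
    (θ : stdSimplex ℝ (Fin (d + 1))) (y : Y) : ℝ :=
  ∑ x : Fin n → Fin (d + 1), sampleProb θ x * W x y

/-- The risk `𝔼_θ ‖est(Y) - θ‖₂²` of the estimator `est` under the distribution `θ`. -/
noncomputable def risk {n d : ℕ} {Y : Type} [Fintype Y] (W : (Fin n → Fin (d + 1)) → Y → ℝ)
    (est : Y → EuclideanSpace ℝ (Fin (d + 1))) (θ : stdSimplex ℝ (Fin (d + 1))) : ℝ :=
  ∑ y : Y, transcriptProb W θ y * ‖est y - WithLp.toLp 2 θ.1‖ ^ 2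

/-- The worst-case risk over the simplex. The risk is a continuous function on a compact set, hence
bounded, so that this is a genuine supremum. -/
noncomputable def worstCaseRisk {n d : ℕ} {Y : Type} [Fintype Y]
    (W : (Fin n → Fin (d + 1)) → Y → ℝ) (est : Y → EuclideanSpace ℝ (Fin (d + 1))) : ℝ :=
  ⨆ θ : stdSimplex ℝ (Fin (d + 1)), risk W est θ

/-! This is Assouad's method on the cube of points `perturbed d ε σ`. In all three models the
transcript law factors as `∏ i, h i y (x i)` with `h` in `[0, 1]`, so under i.i.d. samples it stays
a product over nodes, `∏ i, ∑ a, θ a * h i y a`. Only two facts about the protocol are used: the law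
has mass 1, and deleting one node's factor leaves mass at most `2 ^ k`.

The overlap of the laws at two neighbouring points is at least `log 2` minus their divergence
(`log_two_le_sum_min_add`), and the divergence splits into one `χ²` term per node. Summed over the
`d` directions, one node contributes at most `32 ε² d min (2 ^ k) d` (`sum_flip_node_le`). With `ε²`
of order `1 / (n min (2 ^ k) d)` the average overlap stays bounded below, so each of the `d`
coordinates costs order `ε²`, and `d ε²` is the claimed rate. -/

open Finset

/-! ### Total mass of product kernels and their mixtures -/

/-- The iterated kernels `f t` define a probability distribution on sequences. -/
theorem sum_prod_take_eq_one {α : Type*} [Fintype α] (N : ℕ)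
    (f : (t : Fin N) → (Fin t → α) → α → ℝ) (hf : ∀ t v, ∑ a, f t v a = 1) :
    ∑ y : Fin N → α, ∏ t : Fin N, f t (Fin.take t t.isLt.le y) (y t) = 1 := by
  induction N with
  | zero => simp
  | succ N ih =>
    have key : ∀ (y : Fin N → α) (a : α),
        ∏ t : Fin (N + 1), f t (Fin.take t t.isLt.le (Fin.snoc y a : Fin (N + 1) → α))
          ((Fin.snoc y a : Fin (N + 1) → α) t)
        = (∏ t : Fin N, f t.castSucc (Fin.take t t.isLt.le y) (y t)) * f (Fin.last N) y a := by
      intro y a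
      rw [Fin.prod_univ_castSucc]
      congr 1
      · refine Finset.prod_congr rfl fun t _ => ?_
        rw [Fin.snoc_castSucc (α := fun _ => α)]
        exact congrArg (fun v => f t.castSucc v (y t)) (funext fun s =>
          Fin.snoc_castSucc (α := fun _ => α) a y (Fin.castLE t.isLt.le s))
      · rw [Fin.snoc_last (α := fun _ => α)]
        exact congrArg (fun v => f (Fin.last N) v a) (funext fun s =>
          Fin.snoc_castSucc (α := fun _ => α) a y s)
    rw [← (Fin.snocEquiv fun _ : Fin (N + 1) => α).sum_comp, Fintype.sum_prod_type_right]
    simp only [Fin.snocEquiv, Equiv.coe_fn_mk, key, ← Finset.mul_sum, hf, mul_one]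
    exact ih (fun t => f t.castSucc) fun t => hf t.castSucc

/-- Mixing a family of product kernels node by node preserves the total mass. -/
theorem sum_prod_mixture {n : ℕ} {A Y : Type*} [Fintype A] [DecidableEq A] [Fintype Y]
    (w : Fin n → A → ℝ) (h : Fin n → Y → A → ℝ) :
    ∑ y, ∏ i, ∑ a, w i a * h i y a
      = ∑ x : Fin n → A, (∏ i, w i (x i)) * ∑ y, ∏ i, h i y (x i) := by
  simp_rw [Finset.prod_univ_sum, Fintype.piFinset_univ, Finset.prod_mul_distrib, Finset.mul_sum]
  exact Finset.sum_comm

theorem sum_prod_weights {n : ℕ} {A : Type*} [Fintype A] [DecidableEq A] (w : Fin n → A → ℝ)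
    (hw : ∀ i, ∑ a, w i a = 1) : ∑ x : Fin n → A, ∏ i, w i (x i) = 1 := by
  have := Finset.prod_univ_sum (fun _ : Fin n => (Finset.univ : Finset A)) w
  rw [Fintype.piFinset_univ] at this
  rw [← this]
  simp [hw]

theorem sum_prod_mixture_le {n : ℕ} {A Y : Type*} [Fintype A] [DecidableEq A] [Fintype Y]
    (w : Fin n → A → ℝ) (h : Fin n → Y → A → ℝ) (hw0 : ∀ i a, 0 ≤ w i a)
    (hw : ∀ i, ∑ a, w i a = 1) {c : ℝ} (hc : ∀ x : Fin n → A, ∑ y, ∏ i, h i y (x i) ≤ c) :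
    ∑ y, ∏ i, ∑ a, w i a * h i y a ≤ c := by
  rw [sum_prod_mixture]
  calc _ ≤ ∑ x : Fin n → A, (∏ i, w i (x i)) * c :=
        Finset.sum_le_sum fun x _ =>
          mul_le_mul_of_nonneg_left (hc x) (Finset.prod_nonneg fun i _ => hw0 i _)
    _ = c := by rw [← Finset.sum_mul, sum_prod_weights w hw, one_mul]

/-- The weights may vary with the node, so one node can be given a different law, or a point mass,
while the others keep theirs. -/
theorem sum_prod_mixture_eq_one {n : ℕ} {A Y : Type*} [Fintype A] [DecidableEq A] [Fintype Y]
    (w : Fin n → A → ℝ) (h : Fin n → Y → A → ℝ)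
    (hw : ∀ i, ∑ a, w i a = 1) (hc : ∀ x : Fin n → A, ∑ y, ∏ i, h i y (x i) = 1) :
    ∑ y, ∏ i, ∑ a, w i a * h i y a = 1 := by
  rw [sum_prod_mixture]
  simp only [hc, mul_one]
  exact sum_prod_weights w hw

theorem transcriptProb_eq_prod {n d : ℕ} {Y : Type} (h : Fin n → Y → Fin (d + 1) → ℝ)
    (θ : stdSimplex ℝ (Fin (d + 1))) (y : Y) :
    transcriptProb (fun x y => ∏ i, h i y (x i)) θ y = ∏ i, ∑ a, θ.1 a * h i y a := by
  simp_rw [transcriptProb, sampleProb, Finset.prod_univ_sum, Fintype.piFinset_univ,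
    Finset.prod_mul_distrib]

theorem risk_le_worstCaseRisk {n d : ℕ} {Y : Type} [Fintype Y]
    (W : (Fin n → Fin (d + 1)) → Y → ℝ) (est : Y → EuclideanSpace ℝ (Fin (d + 1)))
    (θ : stdSimplex ℝ (Fin (d + 1))) : risk W est θ ≤ worstCaseRisk W est := by
  -- A real `⨆` over an unbounded family is `0` by default, so boundedness has to be supplied; it
  -- comes from compactness of the simplex.
  refine le_ciSup (f := fun θ => risk W est θ) ?_ θ
  have hc : Continuous fun θ : stdSimplex ℝ (Fin (d + 1)) => risk W est θ := by
    have hcoord : ∀ a, Continuous fun θ : stdSimplex ℝ (Fin (d + 1)) => θ.1 a := fun a =>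
      (continuous_apply a).comp continuous_subtype_val
    have hlp : Continuous fun θ : stdSimplex ℝ (Fin (d + 1)) => WithLp.toLp 2 θ.1 :=
      (PiLp.continuous_toLp 2 _).comp continuous_subtype_val
    refine continuous_finsetSum _ fun y _ => Continuous.mul ?_ ?_
    · exact continuous_finsetSum _ fun x _ =>
        (continuous_finsetProd _ fun i _ => hcoord (x i)).mul continuous_const
    · exact ((continuous_const.sub hlp).norm).pow 2
  exact (isCompact_range hc).bddAbove

/-! ### Comparison of two product-form transcript laws -/

/-- Pointwise form of `∑ min (P, Q) ≥ log 2 - KL(P, Q)` for product densities, with the logarithm of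
each likelihood ratio bounded linearly. -/
theorem prod_mul_log_two_le {ι : Type*} [Fintype ι] (a b : ι → ℝ) (ha : ∀ i, 0 ≤ a i)
    (hb : ∀ i, 0 ≤ b i) (hab : ∀ i, b i = 0 → a i = 0) :
    (∏ i, a i) * Real.log 2 ≤ min (∏ i, a i) (∏ i, b i)
      + ∑ i, (∏ i, a i) * (a i / b i - 1) - ∏ i, a i + ∏ i, b i := by
  have hP : 0 ≤ ∏ i, a i := Finset.prod_nonneg fun i _ => ha i
  have hQ : 0 ≤ ∏ i, b i := Finset.prod_nonneg fun i _ => hb i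
  rw [← Finset.mul_sum]
  rcases hP.eq_or_lt with h0 | hpos
  · rw [← h0, min_eq_left hQ]
    simpa using hQ
  have ha' : ∀ i, 0 < a i := fun i =>
    (ha i).lt_of_ne' (Finset.prod_ne_zero_iff.1 hpos.ne' i (Finset.mem_univ i))
  have hb' : ∀ i, 0 < b i := fun i => (hb i).lt_of_ne' fun h => (ha' i).ne' (hab i h)
  have hQpos : 0 < ∏ i, b i := Finset.prod_pos fun i _ => hb' i
  have hlog : Real.log ((∏ i, a i) / ∏ i, b i) ≤ ∑ i, (a i / b i - 1) := by
    rw [← Finset.prod_div_distrib, Real.log_prod fun i _ => (div_pos (ha' i) (hb' i)).ne']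
    exact Finset.sum_le_sum fun i _ => Real.log_le_sub_one_of_pos (div_pos (ha' i) (hb' i))
  generalize (∑ i, (a i / b i - 1)) = S at *
  generalize (∏ i, a i) = P at *
  generalize (∏ i, b i) = Q at *
  have hS := mul_le_mul_of_nonneg_left hlog hP
  have hl2 : Real.log 2 < 1 := by linarith [Real.log_two_lt_d9]
  have hdiv : Real.log (P / Q) = -Real.log (Q / P) := by rw [← Real.log_inv, inv_div]
  rcases le_total P Q with h | h
  · rw [min_eq_left h]
    have := Real.log_le_sub_one_of_pos (div_pos hQpos hpos)
    have h2 := mul_le_mul_of_nonneg_left this hP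
    have h3 : P * (Q / P - 1) = Q - P := by field_simp
    rw [hdiv] at hS
    nlinarith
  · rw [min_eq_right h]
    -- The bound `log t ≤ t - 1` is taken at `t = 2Q/P`; this is the source of `log 2`.
    have := Real.log_le_sub_one_of_pos (show 0 < 2 * (Q / P) by positivity)
    rw [Real.log_mul two_ne_zero (div_pos hQpos hpos).ne'] at this
    have h2 := mul_le_mul_of_nonneg_left this hP
    have h3 : P * (2 * (Q / P) - 1) = 2 * Q - P := by field_simp
    rw [hdiv] at hS
    nlinarith

/-- `∑ min (P, Q) ≥ log 2 - KL(P, Q)` for two product-form transcript laws, with the divergence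
bounded by the sum over the nodes of `χ²`-type terms. -/
theorem log_two_le_sum_min_add {n : ℕ} {A Y : Type*} [Fintype A] [DecidableEq A] [Fintype Y]
    (h : Fin n → Y → A → ℝ) (h0 : ∀ i y a, 0 ≤ h i y a)
    (hA : ∀ x : Fin n → A, ∑ y, ∏ i, h i y (x i) = 1)
    (p q : A → ℝ) (hp : ∀ a, 0 < p a) (hq : ∀ a, 0 < q a) (hp1 : ∑ a, p a = 1)
    (hq1 : ∑ a, q a = 1) :
    Real.log 2 ≤ ∑ y, min (∏ i, ∑ a, p a * h i y a) (∏ i, ∑ a, q a * h i y a)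
      + ∑ i, ∑ y, (∏ l ∈ univ.erase i, ∑ a, p a * h l y a) *
        ((∑ a, p a * h i y a - ∑ a, q a * h i y a) ^ 2 / ∑ a, q a * h i y a) := by
  have nn : ∀ w : A → ℝ, (∀ a, 0 < w a) → ∀ i y, 0 ≤ ∑ a, w a * h i y a := fun w hw i y =>
    Finset.sum_nonneg fun a _ => mul_nonneg (hw a).le (h0 i y a)
  have hz : ∀ i y, ∑ a, q a * h i y a = 0 → ∑ a, p a * h i y a = 0 := by
    intro i y hy
    rw [Finset.sum_eq_zero_iff_of_nonneg fun a _ => mul_nonneg (hq a).le (h0 i y a)] at hy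
    refine Finset.sum_eq_zero fun a ha => ?_
    rw [(mul_eq_zero.1 (hy a ha)).resolve_left (hq a).ne', mul_zero]
  -- Giving node `i` any other sample law `w` still yields a probability distribution on
  -- transcripts.
  have hone : ∀ i (w : A → ℝ), ∑ a, w a = 1 →
      ∑ y, (∏ l ∈ univ.erase i, ∑ a, p a * h l y a) * ∑ a, w a * h i y a = 1 := by
    intro i w hw
    rw [← sum_prod_mixture_eq_one (Function.update (fun _ => p) i w) h _ hA]
    · refine Finset.sum_congr rfl fun y _ => ?_
      rw [← Finset.prod_erase_mul _ _ (Finset.mem_univ i)]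
      congr 1
      · refine Finset.prod_congr rfl fun l hl => ?_
        rw [Function.update_of_ne (Finset.ne_of_mem_erase hl)]
      · rw [Function.update_self]
    · intro l
      by_cases hl : l = i
      · subst hl; rw [Function.update_self, hw]
      · rw [Function.update_of_ne hl, hp1]
  have hP1 := sum_prod_mixture_eq_one (fun _ => p) h (fun _ => hp1) hA
  have hQ1 := sum_prod_mixture_eq_one (fun _ => q) h (fun _ => hq1) hA
  have hsum := Finset.sum_le_sum fun y (_ : y ∈ univ) =>
    prod_mul_log_two_le (fun i => ∑ a, p a * h i y a) (fun i => ∑ a, q a * h i y a)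
      (fun i => nn p hp i y) (fun i => nn q hq i y) (fun i => hz i y)
  rw [← Finset.sum_mul, hP1, one_mul, Finset.sum_add_distrib, Finset.sum_sub_distrib,
    Finset.sum_add_distrib, hP1, hQ1, Finset.sum_comm (s := univ) (t := univ)
      (f := fun y i => (∏ i, ∑ a, p a * h i y a) *
        ((∑ a, p a * h i y a) / (∑ a, q a * h i y a) - 1))] at hsum
  have hterm : ∀ i, ∑ y, (∏ i, ∑ a, p a * h i y a) *
        ((∑ a, p a * h i y a) / (∑ a, q a * h i y a) - 1)
      = ∑ y, (∏ l ∈ univ.erase i, ∑ a, p a * h l y a) *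
        ((∑ a, p a * h i y a - ∑ a, q a * h i y a) ^ 2 / ∑ a, q a * h i y a) := by
    intro i
    -- With `a`, `b` the two mixtures at node `i`, `a (a/b - 1) - (a - b)²/b = a - b`. Weighted by
    -- the other nodes' factors this sums to `1 - 1` by `hone`.
    rw [← sub_eq_zero, ← sub_self (1 : ℝ)]
    refine Eq.trans ?_ (congrArg₂ (· - ·) (hone i p hp1) (hone i q hq1))
    refine (Finset.sum_sub_distrib _ _).symm.trans
      (Eq.trans ?_ (Finset.sum_sub_distrib _ _))
    refine Finset.sum_congr rfl fun y _ => ?_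
    rw [← Finset.prod_erase_mul _ _ (Finset.mem_univ i)]
    by_cases hy : ∑ a, q a * h i y a = 0
    · simp [hy, hz i y hy]
    · field_simp
      ring
  simp only [hterm] at hsum
  linarith

/-! ### The hypercube of perturbations -/

/-- The sign of a Boolean. -/
def boolSign (b : Bool) : ℝ := if b then 1 else -1

/-- The point of the simplex obtained from `(1/(2d), …, 1/(2d), 1/2)` by moving the first `d`
coordinates by `± ε`. -/
noncomputable def perturbed (d : ℕ) (ε : ℝ) (σ : Fin d → Bool) : Fin (d + 1) → ℝ :=
  Fin.snoc (α := fun _ => ℝ) (fun j => 1 / (2 * d) + ε * boolSign (σ j))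
    (1 / 2 - ∑ j, ε * boolSign (σ j))

/-- Flip one bit. -/
def flipBit {d : ℕ} (j : Fin d) (σ : Fin d → Bool) : Fin d → Bool :=
  Function.update σ j (!σ j)

theorem flipBit_involutive {d : ℕ} (j : Fin d) : Function.Involutive (flipBit j) := by
  intro σ
  simp [flipBit]

theorem abs_mul_boolSign {ε : ℝ} (hε : 0 ≤ ε) (b : Bool) : |ε * boolSign b| = ε := by
  cases b <;> simp [boolSign, abs_of_nonneg hε]

theorem boolSign_not (b : Bool) : boolSign (!b) = -boolSign b := by
  cases b <;> simp [boolSign]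

theorem boolSign_sq (b : Bool) : boolSign b ^ 2 = 1 := by
  cases b <;> simp [boolSign]

section perturbed

variable {d : ℕ} {ε : ℝ}

theorem perturbed_castSucc (σ : Fin d → Bool) (j : Fin d) :
    perturbed d ε σ j.castSucc = 1 / (2 * d) + ε * boolSign (σ j) :=
  Fin.snoc_castSucc (α := fun _ => ℝ) _ _ _

theorem perturbed_last (σ : Fin d → Bool) :
    perturbed d ε σ (Fin.last d) = 1 / 2 - ∑ j, ε * boolSign (σ j) :=
  Fin.snoc_last (α := fun _ => ℝ) _ _

theorem sum_perturbed (hd : 1 ≤ d) (σ : Fin d → Bool) : ∑ a, perturbed d ε σ a = 1 := by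
  have : (d : ℝ) ≠ 0 := by positivity
  rw [Fin.sum_univ_castSucc]
  simp only [perturbed_castSucc, perturbed_last, Finset.sum_add_distrib, Finset.sum_const,
    Finset.card_univ, Fintype.card_fin, nsmul_eq_mul]
  field_simp
  ring

theorem le_perturbed_castSucc (hε : 0 ≤ ε) (hεd : ε ≤ 1 / (4 * d)) (σ : Fin d → Bool)
    (j : Fin d) : 1 / (4 * d) ≤ perturbed d ε σ j.castSucc := by
  rw [perturbed_castSucc]
  have := (abs_le.1 (abs_mul_boolSign hε (σ j)).le).1
  have h2 : (1 : ℝ) / (2 * d) = 1 / (4 * d) + 1 / (4 * d) := by ring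
  linarith

theorem le_perturbed_last (hd : 1 ≤ d) (hε : 0 ≤ ε) (hεd : ε ≤ 1 / (4 * d)) (σ : Fin d → Bool) :
    1 / 4 ≤ perturbed d ε σ (Fin.last d) := by
  rw [perturbed_last]
  have h1 : ∑ j, ε * boolSign (σ j) ≤ ∑ _j : Fin d, 1 / (4 * (d : ℝ)) :=
    Finset.sum_le_sum fun j _ =>
      (le_abs_self _).trans ((abs_mul_boolSign hε (σ j)).le.trans hεd)
  have h2 : ∑ _j : Fin d, 1 / (4 * (d : ℝ)) = 1 / 4 := by
    have : (d : ℝ) ≠ 0 := by positivity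
    simp only [Finset.sum_const, Finset.card_univ, Fintype.card_fin, nsmul_eq_mul]
    field_simp
  linarith

theorem perturbed_pos (hd : 1 ≤ d) (hε : 0 ≤ ε) (hεd : ε ≤ 1 / (4 * d)) (σ : Fin d → Bool)
    (a : Fin (d + 1)) : 0 < perturbed d ε σ a := by
  have : (0 : ℝ) < d := by positivity
  refine Fin.lastCases ?_ (fun j => ?_) a
  · linarith [le_perturbed_last hd hε hεd σ]
  · exact lt_of_lt_of_le (by positivity) (le_perturbed_castSucc hε hεd σ j)

/-- Flipping bit `j` moves mass `2ε` between coordinate `j` and the last one and changes nothing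
else. -/
theorem perturbed_sub_flipBit (σ : Fin d → Bool) (j : Fin d) (u : Fin (d + 1) → ℝ) :
    ∑ a, perturbed d ε σ a * u a - ∑ a, perturbed d ε (flipBit j σ) a * u a
      = 2 * ε * boolSign (σ j) * (u j.castSucc - u (Fin.last d)) := by
  have h1 : ∀ l, boolSign (σ l) - boolSign (flipBit j σ l)
      = if l = j then 2 * boolSign (σ j) else 0 := by
    intro l
    by_cases hl : l = j
    · subst hl; simp [flipBit, boolSign_not]; ring
    · simp [flipBit, hl]
  rw [← Finset.sum_sub_distrib, Fin.sum_univ_castSucc]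
  have h2 : ∀ l : Fin d, perturbed d ε σ l.castSucc * u l.castSucc
      - perturbed d ε (flipBit j σ) l.castSucc * u l.castSucc
      = if l = j then 2 * ε * boolSign (σ j) * u j.castSucc else 0 := by
    intro l
    have := h1 l
    simp only [perturbed_castSucc]
    by_cases hl : l = j
    · subst hl
      simp only [if_true] at this ⊢
      linear_combination ε * u l.castSucc * this
    · simp only [hl, if_false] at this ⊢
      linear_combination ε * u l.castSucc * this
  have h3 : ∑ l, ε * boolSign (σ l) - ∑ l, ε * boolSign (flipBit j σ l)
      = 2 * ε * boolSign (σ j) := by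
    rw [← Finset.sum_sub_distrib]
    simp_rw [← mul_sub, h1]
    simp
    ring
  simp only [h2, perturbed_last]
  simp only [Finset.sum_ite_eq', Finset.mem_univ, if_true]
  linear_combination -u (Fin.last d) * h3

/-- For a kernel `u` with values in `[0, 1]` the sum over the coordinates of the `χ²`-type terms is
`O(d)`. -/
theorem sum_sq_div_le_four_mul (hd : 1 ≤ d) (hε : 0 ≤ ε) (hεd : ε ≤ 1 / (4 * d))
    (τ : Fin d → Fin d → Bool) (u : Fin (d + 1) → ℝ) (u0 : ∀ a, 0 ≤ u a) (u1 : ∀ a, u a ≤ 1) :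
    ∑ j : Fin d, (u j.castSucc - u (Fin.last d)) ^ 2 / ∑ a, perturbed d ε (τ j) a * u a
      ≤ 4 * d := by
  have hd0 : (0 : ℝ) < d := by positivity
  -- `L / (4d)` bounds every denominator from below, whatever the signs, while `(s - t)² ≤ s + t` on
  -- `[0, 1]` bounds the numerators' sum by `L`.
  set L : ℝ := ∑ j : Fin d, u j.castSucc + d * u (Fin.last d) with hL
  have hL0 : 0 ≤ L := add_nonneg (Finset.sum_nonneg fun _ _ => u0 _) (mul_nonneg hd0.le (u0 _))
  have hq : ∀ σ, L / (4 * d) ≤ ∑ a, perturbed d ε σ a * u a := by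
    intro σ
    rw [Fin.sum_univ_castSucc, hL, add_div, Finset.sum_div]
    refine add_le_add (Finset.sum_le_sum fun j _ => ?_) ?_
    · have := mul_le_mul_of_nonneg_right (le_perturbed_castSucc hε hεd σ j) (u0 j.castSucc)
      calc _ = 1 / (4 * d) * u j.castSucc := by ring
        _ ≤ _ := this
    · have := mul_le_mul_of_nonneg_right (le_perturbed_last hd hε hεd σ) (u0 (Fin.last d))
      calc _ = 1 / 4 * u (Fin.last d) := by field_simp
        _ ≤ _ := this
  have hsq : ∀ j : Fin d, (u j.castSucc - u (Fin.last d)) ^ 2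
      ≤ u j.castSucc + u (Fin.last d) := by
    intro j
    nlinarith [u0 j.castSucc, u1 j.castSucc, u0 (Fin.last d), u1 (Fin.last d),
      mul_nonneg (u0 j.castSucc) (u0 (Fin.last d))]
  rcases hL0.eq_or_lt with h0 | hpos
  · have hz := h0.symm
    rw [hL, add_eq_zero_iff_of_nonneg (Finset.sum_nonneg fun _ _ => u0 _)
      (mul_nonneg hd0.le (u0 _)), Finset.sum_eq_zero_iff_of_nonneg fun _ _ => u0 _] at hz
    have hl : u (Fin.last d) = 0 := (mul_eq_zero.1 hz.2).resolve_left hd0.ne'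
    rw [Finset.sum_eq_zero fun j hj => by rw [hz.1 j hj, hl]; simp]
    positivity
  · calc _ ≤ ∑ j : Fin d, (u j.castSucc + u (Fin.last d)) / (L / (4 * d)) := by
          refine Finset.sum_le_sum fun j _ => ?_
          exact div_le_div₀ (add_nonneg (u0 _) (u0 _)) (hsq j) (by positivity) (hq _)
      _ = L / (L / (4 * d)) := by
          rw [← Finset.sum_div, Finset.sum_add_distrib, hL]
          simp
      _ = 4 * d := by field_simp

/-- A bound of the same sum by the total mass of the kernel. -/
theorem sum_sq_div_le_mul_sum (hd : 1 ≤ d) (hε : 0 ≤ ε) (hεd : ε ≤ 1 / (4 * d))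
    (τ : Fin d → Fin d → Bool) (u : Fin (d + 1) → ℝ) (u0 : ∀ a, 0 ≤ u a) :
    ∑ j : Fin d, (u j.castSucc - u (Fin.last d)) ^ 2 / ∑ a, perturbed d ε (τ j) a * u a
      ≤ 4 * d * ∑ a, u a := by
  have hd0 : (0 : ℝ) < d := by positivity
  have hle : ∀ σ a, perturbed d ε σ a * u a ≤ ∑ a, perturbed d ε σ a * u a := fun σ a =>
    Finset.single_le_sum (f := fun a => perturbed d ε σ a * u a)
      (fun a _ => mul_nonneg (perturbed_pos hd hε hεd σ a).le (u0 a)) (Finset.mem_univ a)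
  have hq0 : ∀ σ, 0 ≤ ∑ a, perturbed d ε σ a * u a := fun σ =>
    Finset.sum_nonneg fun a _ => mul_nonneg (perturbed_pos hd hε hεd σ a).le (u0 a)
  -- Here `(s - t)² ≤ s² + t²`, and the denominator `q` satisfies `s ≤ 4dq` and `t ≤ 4q`.
  have hterm : ∀ j : Fin d,
      (u j.castSucc - u (Fin.last d)) ^ 2 / ∑ a, perturbed d ε (τ j) a * u a
        ≤ 4 * d * u j.castSucc + 4 * u (Fin.last d) := by
    intro j
    have hj := (mul_le_mul_of_nonneg_right (le_perturbed_castSucc hε hεd (τ j) j)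
      (u0 j.castSucc)).trans (hle (τ j) j.castSucc)
    have hl := (mul_le_mul_of_nonneg_right (le_perturbed_last hd hε hεd (τ j))
      (u0 (Fin.last d))).trans (hle (τ j) (Fin.last d))
    refine div_le_of_le_mul₀ (hq0 _) ?_ ?_
    · have := u0 j.castSucc
      have := u0 (Fin.last d)
      positivity
    · generalize (∑ a, perturbed d ε (τ j) a * u a) = q at *
      have hj' : u j.castSucc ≤ 4 * d * q := by
        rw [one_div, inv_mul_le_iff₀ (by positivity)] at hj
        exact hj
      nlinarith [u0 j.castSucc, u0 (Fin.last d), mul_nonneg (u0 j.castSucc) (u0 (Fin.last d)),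
        mul_le_mul_of_nonneg_left hj' (u0 j.castSucc),
        mul_le_mul_of_nonneg_left hl (u0 (Fin.last d))]
  refine (Finset.sum_le_sum fun j _ => hterm j).trans (le_of_eq ?_)
  rw [Finset.sum_add_distrib, ← Finset.mul_sum, Fin.sum_univ_castSucc]
  simp
  ring

end perturbed

/-! ### The lower bound for product-form transcripts -/

section ProductForm

variable {n k d : ℕ} {Y : Type} [Fintype Y] {ε : ℝ} {h : Fin n → Y → Fin (d + 1) → ℝ}

/-- The contribution of one node to the divergences between neighbouring points of the cube. -/
theorem sum_flip_node_le (hd : 1 ≤ d) (hε : 0 ≤ ε) (hεd : ε ≤ 1 / (4 * d))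
    (h0 : ∀ i y a, 0 ≤ h i y a) (h1 : ∀ i y a, h i y a ≤ 1)
    (hA : ∀ x : Fin n → Fin (d + 1), ∑ y, ∏ i, h i y (x i) = 1)
    (hB : ∀ (i : Fin n) (x : Fin n → Fin (d + 1)),
      ∑ y, ∏ l ∈ univ.erase i, h l y (x l) ≤ 2 ^ k)
    (σ : Fin d → Bool) (i : Fin n) :
    ∑ j, ∑ y, (∏ l ∈ univ.erase i, ∑ a, perturbed d ε σ a * h l y a) *
        ((∑ a, perturbed d ε σ a * h i y a - ∑ a, perturbed d ε (flipBit j σ) a * h i y a) ^ 2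
          / ∑ a, perturbed d ε (flipBit j σ) a * h i y a)
      ≤ 32 * ε ^ 2 * d * ((min (2 ^ k) d : ℕ) : ℝ) := by
  have hd1 : (1 : ℝ) ≤ d := by exact_mod_cast hd
  have hp0 : ∀ a, 0 ≤ perturbed d ε σ a := fun a => (perturbed_pos hd hε hεd σ a).le
  set R : Y → ℝ := fun y => ∏ l ∈ univ.erase i, ∑ a, perturbed d ε σ a * h l y a with hR
  set S : Y → ℝ := fun y => ∑ j : Fin d, (h i y j.castSucc - h i y (Fin.last d)) ^ 2
    / ∑ a, perturbed d ε (flipBit j σ) a * h i y a with hS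
  have hR0 : ∀ y, 0 ≤ R y := fun y =>
    Finset.prod_nonneg fun l _ => Finset.sum_nonneg fun a _ => mul_nonneg (hp0 a) (h0 l y a)
  -- Restoring a factor at node `i` puts the expression back in the form covered by the mixture
  -- lemmas.
  have hupd : ∀ (g : Y → Fin (d + 1) → ℝ) (w : Fin (d + 1) → ℝ) (y : Y),
      R y * ∑ a, w a * g y a = ∏ l, ∑ a,
        Function.update (fun _ : Fin n => perturbed d ε σ) i w l a
          * Function.update h i g l y a := by
    intro g w y
    rw [← Finset.prod_erase_mul _ _ (Finset.mem_univ i), Function.update_self,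
      Function.update_self]
    congr 1
    refine Finset.prod_congr rfl fun l hl => ?_
    rw [Function.update_of_ne (Finset.ne_of_mem_erase hl),
      Function.update_of_ne (Finset.ne_of_mem_erase hl)]
  -- The constant kernel `1` at node `i` turns `R` into a full product without changing it.
  have hRB : ∑ y, R y ≤ 2 ^ k := by
    have hc := sum_prod_mixture_le (fun _ : Fin n => perturbed d ε σ)
      (Function.update h i fun _ _ => 1) (fun _ => hp0) (fun _ => sum_perturbed hd σ)
      (c := 2 ^ k) ?_
    · refine le_trans (le_of_eq (Finset.sum_congr rfl fun y _ => ?_)) hc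
      have := hupd (fun _ _ => 1) (perturbed d ε σ) y
      rw [Function.update_eq_self_iff.2 rfl] at this
      rw [← this]
      simp [sum_perturbed hd σ]
    · intro x
      refine le_trans (le_of_eq (Finset.sum_congr rfl fun y _ => ?_)) (hB i x)
      rw [← Finset.prod_erase_mul _ _ (Finset.mem_univ i), Function.update_self, mul_one]
      refine Finset.prod_congr rfl fun l hl => ?_
      rw [Function.update_of_ne (Finset.ne_of_mem_erase hl)]
  -- Node `i` is given the point mass at `b`.
  have hRA : ∀ b, ∑ y, R y * h i y b = 1 := by
    intro b
    rw [← sum_prod_mixture_eq_one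
      (Function.update (fun _ : Fin n => perturbed d ε σ) i (Pi.single b 1)) h ?_ hA]
    · refine Finset.sum_congr rfl fun y _ => ?_
      have := hupd (h i) (Pi.single b 1) y
      rw [Function.update_eq_self] at this
      rw [← this]
      simp [Pi.single_apply]
    · intro l
      by_cases hl : l = i
      · subst hl; simp
      · rw [Function.update_of_ne hl, sum_perturbed hd σ]
  have heq : ∑ j, ∑ y, R y *
        ((∑ a, perturbed d ε σ a * h i y a - ∑ a, perturbed d ε (flipBit j σ) a * h i y a) ^ 2
          / ∑ a, perturbed d ε (flipBit j σ) a * h i y a)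
      = 4 * ε ^ 2 * ∑ y, R y * S y := by
    rw [Finset.sum_comm, Finset.mul_sum]
    refine Finset.sum_congr rfl fun y _ => ?_
    rw [hS, Finset.mul_sum, Finset.mul_sum]
    refine Finset.sum_congr rfl fun j _ => ?_
    rw [perturbed_sub_flipBit, mul_pow, mul_pow, boolSign_sq]
    ring
  have hS1 : ∑ y, R y * S y ≤ 4 * d * 2 ^ k := by
    calc _ ≤ ∑ y, R y * (4 * d) := Finset.sum_le_sum fun y _ => mul_le_mul_of_nonneg_left
          (sum_sq_div_le_four_mul hd hε hεd (fun j => flipBit j σ) (h i y) (h0 i y) (h1 i y))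
          (hR0 y)
      _ = 4 * d * ∑ y, R y := by rw [← Finset.sum_mul, mul_comm]
      _ ≤ _ := mul_le_mul_of_nonneg_left hRB (by positivity)
  have hS2 : ∑ y, R y * S y ≤ 4 * d * (d + 1) := by
    calc _ ≤ ∑ y, R y * (4 * d * ∑ a, h i y a) :=
          Finset.sum_le_sum fun y _ => mul_le_mul_of_nonneg_left
            (sum_sq_div_le_mul_sum hd hε hεd (fun j => flipBit j σ) (h i y) (h0 i y)) (hR0 y)
      _ = 4 * d * ∑ a, ∑ y, R y * h i y a := by
          rw [Finset.sum_comm, Finset.mul_sum]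
          refine Finset.sum_congr rfl fun y _ => ?_
          rw [← Finset.mul_sum]
          ring
      _ = _ := by simp [hRA]
  rw [heq]
  -- `d + 1 ≤ 2d` absorbs the second bound into the constant `8`.
  have hM : ∑ y, R y * S y ≤ 8 * d * ((min (2 ^ k) d : ℕ) : ℝ) := by
    rcases min_choice (2 ^ k) d with hm | hm <;> rw [hm]
    · push_cast
      have : (0 : ℝ) ≤ d * 2 ^ k := by positivity
      linarith
    · nlinarith
  calc _ ≤ 4 * ε ^ 2 * (8 * d * ((min (2 ^ k) d : ℕ) : ℝ)) :=
        mul_le_mul_of_nonneg_left hM (by positivity)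
    _ = _ := by ring

/-- No single guess `e` is close to both `a` and `b`: by the parallelogram identity `(e - a)² + (e -
b)² ≥ (a - b)²/2`. -/
theorem min_mul_sq_le (P Q e a b : ℝ) (hP : 0 ≤ P) (hQ : 0 ≤ Q) :
    min P Q * ((a - b) ^ 2 / 2) ≤ P * (e - a) ^ 2 + Q * (e - b) ^ 2 := by
  have h1 := mul_le_mul_of_nonneg_right (min_le_left P Q) (sq_nonneg (e - a))
  have h2 := mul_le_mul_of_nonneg_right (min_le_right P Q) (sq_nonneg (e - b))
  have h3 : 0 ≤ min P Q := le_min hP hQ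
  have h4 := mul_nonneg h3 (sq_nonneg (e - a + (e - b)))
  nlinarith

/-- Assouad's reduction: the total risk over the cube is bounded below by the overlaps of the laws
at neighbouring points. -/
theorem sum_min_le_sum_sq (P : (Fin d → Bool) → Y → ℝ) (hP : ∀ σ y, 0 ≤ P σ y)
    (e : Y → ℝ) (j : Fin d) :
    ∑ σ, ε ^ 2 * ∑ y, min (P σ y) (P (flipBit j σ) y)
      ≤ ∑ σ, ∑ y, P σ y * (e y - perturbed d ε σ j.castSucc) ^ 2 := by
  set r : (Fin d → Bool) → ℝ := fun σ => ∑ y, P σ y * (e y - perturbed d ε σ j.castSucc) ^ 2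
  -- Flipping permutes the cube, so pairing `σ` with its neighbour counts each risk twice; the
  -- separation `2ε` gives `(2ε)²/2 = 2ε²`.
  have hinv : ∑ σ, r (flipBit j σ) = ∑ σ, r σ :=
    Equiv.sum_comp (flipBit_involutive j).toPerm r
  have hle : ∑ σ, 2 * (ε ^ 2 * ∑ y, min (P σ y) (P (flipBit j σ) y))
      ≤ ∑ σ, (r σ + r (flipBit j σ)) := by
    refine Finset.sum_le_sum fun σ _ => ?_
    rw [← Finset.sum_add_distrib, Finset.mul_sum, Finset.mul_sum]
    refine Finset.sum_le_sum fun y _ => ?_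
    refine le_trans (le_of_eq ?_) (min_mul_sq_le _ _ _ _ _ (hP σ y) (hP (flipBit j σ) y))
    have : perturbed d ε σ j.castSucc - perturbed d ε (flipBit j σ) j.castSucc
        = 2 * ε * boolSign (σ j) := by
      simp only [perturbed_castSucc, flipBit, Function.update_self, boolSign_not]
      ring
    rw [this, mul_pow, boolSign_sq]
    ring
  rw [Finset.sum_add_distrib, hinv, ← Finset.mul_sum] at hle
  linarith

theorem lower_bound_of_product_form (hd : 1 ≤ d) (hn : d ^ 2 ≤ n * min (2 ^ k) d)
    (W : (Fin n → Fin (d + 1)) → Y → ℝ) (hW : ∀ x y, W x y = ∏ i, h i y (x i))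
    (h0 : ∀ i y a, 0 ≤ h i y a) (h1 : ∀ i y a, h i y a ≤ 1)
    (hA : ∀ x : Fin n → Fin (d + 1), ∑ y, ∏ i, h i y (x i) = 1)
    (hB : ∀ (i : Fin n) (x : Fin n → Fin (d + 1)),
      ∑ y, ∏ l ∈ univ.erase i, h l y (x l) ≤ 2 ^ k)
    (est : Y → EuclideanSpace ℝ (Fin (d + 1))) :
    1 / 400 * max ((d : ℝ) / ((n : ℝ) * 2 ^ k)) (1 / (n : ℝ)) ≤ worstCaseRisk W est := by
  obtain rfl : W = fun x y => ∏ i, h i y (x i) := funext fun x => funext fun y => hW x y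
  have hd0 : (0 : ℝ) < d := by positivity
  have hN0 : 0 < n * min (2 ^ k) d := lt_of_lt_of_le (by positivity) hn
  have hn0 : (0 : ℝ) < n := by exact_mod_cast Nat.pos_of_mul_pos_right hN0
  set M : ℝ := ((min (2 ^ k) d : ℕ) : ℝ) with hM
  have hM0 : 0 < M := by rw [hM]; exact_mod_cast Nat.pos_of_mul_pos_left hN0
  have hnM : (d : ℝ) ^ 2 ≤ n * M := by rw [hM]; exact_mod_cast hn
  -- `160 = 5 * 32` makes the total divergence `d / 5`; with `d² ≤ n M` it also gives `ε ≤ 1 /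
  -- (4d)`.
  obtain ⟨ε, hε, hε2⟩ : ∃ ε : ℝ, 0 ≤ ε ∧ ε ^ 2 = 1 / (160 * (n * M)) :=
    ⟨√(1 / (160 * (n * M))), Real.sqrt_nonneg _, Real.sq_sqrt (by positivity)⟩
  have hεd : ε ≤ 1 / (4 * d) := by
    refine le_of_sq_le_sq ?_ (by positivity)
    rw [hε2, div_pow, one_pow]
    refine one_div_le_one_div_of_le (by positivity) ?_
    nlinarith
  let θ : (Fin d → Bool) → stdSimplex ℝ (Fin (d + 1)) := fun σ =>
    ⟨perturbed d ε σ, fun a => (perturbed_pos hd hε hεd σ a).le, sum_perturbed hd σ⟩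
  set P : (Fin d → Bool) → Y → ℝ := fun σ y => ∏ i, ∑ a, perturbed d ε σ a * h i y a with hPdef
  have hP : ∀ σ y, 0 ≤ P σ y := fun σ y => Finset.prod_nonneg fun i _ =>
    Finset.sum_nonneg fun a _ => mul_nonneg (perturbed_pos hd hε hεd σ a).le (h0 i y a)
  have hrisk : ∀ σ, ∑ j : Fin d, ∑ y, P σ y * (est y j.castSucc
      - perturbed d ε σ j.castSucc) ^ 2 ≤ worstCaseRisk (fun x y => ∏ i, h i y (x i)) est := by
    intro σ
    refine le_trans ?_ (risk_le_worstCaseRisk _ est (θ σ))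
    rw [risk, Finset.sum_comm]
    refine Finset.sum_le_sum fun y _ => ?_
    rw [transcriptProb_eq_prod, ← Finset.mul_sum, EuclideanSpace.norm_sq_eq]
    refine mul_le_mul_of_nonneg_left ?_ (hP σ y)
    rw [Fin.sum_univ_castSucc]
    -- The error in the last coordinate is discarded.
    refine le_trans (le_of_eq (Finset.sum_congr rfl fun j _ => ?_))
      (le_add_of_nonneg_right (by positivity))
    rw [Real.norm_eq_abs, sq_abs]
    rfl
  have hover : ∀ σ, (d : ℝ) * (2 / 5) ≤ ∑ j, ∑ y, min (P σ y) (P (flipBit j σ) y) := by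
    intro σ
    have hkl := Finset.sum_le_sum fun j (_ : j ∈ (univ : Finset (Fin d))) =>
      log_two_le_sum_min_add h h0 hA (perturbed d ε σ) (perturbed d ε (flipBit j σ))
        (perturbed_pos hd hε hεd σ) (perturbed_pos hd hε hεd _) (sum_perturbed hd σ)
        (sum_perturbed hd _)
    rw [Finset.sum_add_distrib, Finset.sum_comm (s := univ) (t := univ)
      (f := fun (j : Fin d) (i : Fin n) => ∑ y,
        (∏ l ∈ univ.erase i, ∑ a, perturbed d ε σ a * h l y a) *
        ((∑ a, perturbed d ε σ a * h i y a - ∑ a, perturbed d ε (flipBit j σ) a * h i y a) ^ 2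
          / ∑ a, perturbed d ε (flipBit j σ) a * h i y a))] at hkl
    have hnode := Finset.sum_le_sum fun i (_ : i ∈ (univ : Finset (Fin n))) =>
      sum_flip_node_le hd hε hεd h0 h1 hA hB σ i
    rw [← hM] at hnode
    simp only [Finset.sum_const, Finset.card_univ, Fintype.card_fin, nsmul_eq_mul] at hkl hnode
    have h5 : (n : ℝ) * (32 * ε ^ 2 * d * M) = d / 5 := by
      rw [hε2]
      field_simp
      norm_num
    rw [h5] at hnode
    -- The average overlap is at least `3/5 - 1/5 = 2/5`.
    have hlog := mul_le_mul_of_nonneg_left (show (3 : ℝ) / 5 ≤ Real.log 2 by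
      linarith [Real.log_two_gt_d9]) hd0.le
    linarith
  have htotal : ∑ _σ : Fin d → Bool, ε ^ 2 * (d * (2 / 5))
      ≤ ∑ _σ : Fin d → Bool, worstCaseRisk (fun x y => ∏ i, h i y (x i)) est := by
    calc _ ≤ ∑ σ : Fin d → Bool, ε ^ 2 * ∑ j, ∑ y, min (P σ y) (P (flipBit j σ) y) :=
          Finset.sum_le_sum fun σ _ => mul_le_mul_of_nonneg_left (hover σ) (sq_nonneg ε)
      _ = ∑ j, ∑ σ : Fin d → Bool, ε ^ 2 * ∑ y, min (P σ y) (P (flipBit j σ) y) := by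
          rw [Finset.sum_comm]
          simp only [Finset.mul_sum]
      _ ≤ ∑ j : Fin d, ∑ σ, ∑ y, P σ y * (est y j.castSucc
            - perturbed d ε σ j.castSucc) ^ 2 :=
          Finset.sum_le_sum fun j _ => sum_min_le_sum_sq P hP (fun y => est y j.castSucc) j
      _ ≤ _ := by
          rw [Finset.sum_comm]
          exact Finset.sum_le_sum fun σ _ => hrisk σ
  rw [Finset.sum_const, Finset.sum_const, nsmul_eq_mul, nsmul_eq_mul] at htotal
  -- The constant is `(2/5) / 160 = 1/400`, and the maximum in the claim equals `d / (n M)`.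
  refine le_trans (le_of_eq ?_) (le_of_mul_le_mul_left htotal (by simp))
  have hmax : max ((d : ℝ) / ((n : ℝ) * 2 ^ k)) (1 / (n : ℝ)) = d / (n * M) := by
    have h2k : (0 : ℝ) < 2 ^ k := by positivity
    rw [hM]
    rcases le_total (2 ^ k) d with hc | hc
    · have hc' : (2 : ℝ) ^ k ≤ d := by exact_mod_cast hc
      rw [min_eq_left hc, max_eq_left]
      · push_cast; rfl
      · rw [div_le_div_iff₀ hn0 (by positivity)]
        nlinarith
    · have hc' : (d : ℝ) ≤ 2 ^ k := by exact_mod_cast hc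
      rw [min_eq_right hc, max_eq_right]
      · field_simp
      · rw [div_le_div_iff₀ (by positivity) hn0]
        nlinarith
  rw [hmax, hε2]
  field_simp
  norm_num

end ProductForm

/-! ### Protocols -/

/-- The uniform distribution on `k`-bit messages. -/
noncomputable def uniformMessage (k : ℕ) : stdSimplex ℝ (Fin (2 ^ k)) :=
  ⟨fun _ => (2 ^ k)⁻¹, fun _ => by positivity, by simp⟩

theorem stdSimplex_apply_le_one {ι : Type*} [Fintype ι] (p : stdSimplex ℝ ι) (a : ι) :
    p.1 a ≤ 1 := by
  rw [← p.2.2]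
  exact Finset.single_le_sum (f := p.1) (fun b _ => p.2.1 b) (Finset.mem_univ a)

namespace SeqProtocol

variable {n k : ℕ} {X : Type}

theorem sum_condProb (P : SeqProtocol n k X) (x : Fin n → X) : ∑ m, P.condProb x m = 1 :=
  sum_prod_take_eq_one n (fun i v a => (P.quantizer i v (x i)).1 a)
    fun i v => (P.quantizer i v (x i)).2.2

/-- Without the factor of one node, the conditional law has total mass `2 ^ k`. -/
theorem sum_prod_erase (P : SeqProtocol n k X) (x : Fin n → X) (i : Fin n) :
    ∑ m : Fin n → Fin (2 ^ k), ∏ l ∈ univ.erase i,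
      (P.quantizer l (Fin.take l l.isLt.le m) (x l)).1 (m l) = 2 ^ k := by
  -- If node `i` sends a uniform message instead, its factor is the constant `2⁻ᵏ` and the total
  -- mass is still 1.
  let P' : SeqProtocol n k X :=
    ⟨fun l v a => if l = i then uniformMessage k else P.quantizer l v a⟩
  have hP' := P'.sum_condProb x
  have hm : ∀ m, P'.condProb x m = (∏ l ∈ univ.erase i,
      (P.quantizer l (Fin.take l l.isLt.le m) (x l)).1 (m l)) * (2 ^ k)⁻¹ := by
    intro m
    rw [condProb, ← Finset.prod_erase_mul _ _ (Finset.mem_univ i)]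
    congr 1
    · refine Finset.prod_congr rfl fun l hl => ?_
      simp [P', Finset.ne_of_mem_erase hl]
    · simp [P', uniformMessage]
  simp only [hm, ← Finset.sum_mul] at hP'
  rwa [mul_inv_eq_one₀ (by positivity)] at hP'

theorem lower_bound {d : ℕ} (hd : 1 ≤ d) (hn : d ^ 2 ≤ n * min (2 ^ k) d)
    (P : SeqProtocol n k (Fin (d + 1)))
    (est : (Fin n → Fin (2 ^ k)) → EuclideanSpace ℝ (Fin (d + 1))) :
    1 / 400 * max ((d : ℝ) / ((n : ℝ) * 2 ^ k)) (1 / (n : ℝ)) ≤ worstCaseRisk P.condProb est :=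
  lower_bound_of_product_form (n := n) (d := d) (Y := Fin n → Fin (2 ^ k))
    (h := fun (i : Fin n) (m : Fin n → Fin (2 ^ k)) (a : Fin (d + 1)) =>
      (P.quantizer i (Fin.take i i.isLt.le m) a).1 (m i)) hd hn P.condProb
    (fun _ _ => rfl) (fun _ _ _ => (P.quantizer _ _ _).2.1 _)
    (fun _ _ _ => stdSimplex_apply_le_one _ _) P.sum_condProb
    (fun i x => (P.sum_prod_erase x i).le) est

end SeqProtocol

/-- An independent protocol is a sequential one whose nodes ignore the previous messages. -/
def IndProtocol.toSeqProtocol {n k : ℕ} {X : Type} (P : IndProtocol n k X) :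
    SeqProtocol n k X :=
  ⟨fun i _ => P.quantizer i⟩

namespace BlackboardProtocol

variable {n k : ℕ} {X : Type}

theorem sum_condProb (P : BlackboardProtocol n k X) (x : Fin n → X) :
    ∑ y, P.condProb x y = 1 :=
  sum_prod_take_eq_one (n * k)
    (fun t v (c : Bool) => if c then (P.bitProb t v (x (P.label t v)) : ℝ)
      else 1 - (P.bitProb t v (x (P.label t v)) : ℝ)) fun t v => by simp

/-- The probability that node `i`, holding the sample `a`, writes its bits of the transcript `y`. -/
noncomputable def nodeProb (P : BlackboardProtocol n k X) (i : Fin n) (y : Fin (n * k) → Bool)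
    (a : X) : ℝ :=
  ∏ t ∈ univ.filter fun t : Fin (n * k) => P.label t (Fin.take t t.isLt.le y) = i,
    if y t then (P.bitProb t (Fin.take t t.isLt.le y) a : ℝ)
      else 1 - (P.bitProb t (Fin.take t t.isLt.le y) a : ℝ)

/-- The writer of each bit is determined by the transcript alone, so for fixed `y` the bits can be
grouped by writer, and each group involves one sample. -/
theorem condProb_eq_prod_nodeProb (P : BlackboardProtocol n k X) (x : Fin n → X)
    (y : Fin (n * k) → Bool) : P.condProb x y = ∏ i, P.nodeProb i y (x i) := by
  rw [condProb, ← Finset.prod_fiberwise univ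
    (fun t : Fin (n * k) => P.label t (Fin.take t t.isLt.le y))]
  refine Finset.prod_congr rfl fun i _ => Finset.prod_congr rfl fun t ht => ?_
  simp only [(Finset.mem_filter.1 ht).2]

theorem nodeProb_nonneg (P : BlackboardProtocol n k X) (i : Fin n) (y : Fin (n * k) → Bool)
    (a : X) : 0 ≤ P.nodeProb i y a := by
  refine Finset.prod_nonneg fun t _ => ?_
  split_ifs
  · exact (P.bitProb t _ a).2.1
  · exact sub_nonneg.2 (P.bitProb t _ a).2.2

theorem nodeProb_le_one (P : BlackboardProtocol n k X) (i : Fin n) (y : Fin (n * k) → Bool)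
    (a : X) : P.nodeProb i y a ≤ 1 := by
  refine Finset.prod_le_one (fun t _ => ?_) fun t _ => ?_ <;> split_ifs
  · exact (P.bitProb t _ a).2.1
  · exact sub_nonneg.2 (P.bitProb t _ a).2.2
  · exact (P.bitProb t _ a).2.2
  · exact sub_le_self _ (P.bitProb t _ a).2.1

/-- Without the factor of one node, the conditional law has total mass `2 ^ k`. -/
theorem sum_prod_erase_nodeProb (P : BlackboardProtocol n k X) (x : Fin n → X) (i : Fin n) :
    ∑ y, ∏ l ∈ univ.erase i, P.nodeProb l y (x l) = 2 ^ k := by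
  -- Node `i` tosses fair coins; by `card_label` it writes exactly `k` bits on every path, so its
  -- factor is `2⁻ᵏ`.
  let P' : BlackboardProtocol n k X :=
    ⟨P.label, fun t v a => if P.label t v = i then ⟨1 / 2, by norm_num, by norm_num⟩
      else P.bitProb t v a, P.card_label⟩
  have hP' := P'.sum_condProb x
  have hy : ∀ y, P'.condProb x y
      = (∏ l ∈ univ.erase i, P.nodeProb l y (x l)) * (2 ^ k)⁻¹ := by
    intro y
    rw [condProb_eq_prod_nodeProb, ← Finset.prod_erase_mul _ _ (Finset.mem_univ i)]
    congr 1
    · refine Finset.prod_congr rfl fun l hl => Finset.prod_congr rfl fun t ht => ?_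
      have : P.label t (Fin.take t t.isLt.le y) ≠ i := by
        rw [show P.label t (Fin.take t t.isLt.le y) = l from (Finset.mem_filter.1 ht).2]
        exact Finset.ne_of_mem_erase hl
      simp only [P', this, if_false]
    · rw [nodeProb, Finset.prod_congr rfl (g := fun _ => (2 : ℝ)⁻¹), Finset.prod_const,
        P'.card_label, inv_pow]
      intro t ht
      have : P.label t (Fin.take t t.isLt.le y) = i := (Finset.mem_filter.1 ht).2
      simp only [P', this, if_true]
      split_ifs <;> norm_num
  simp only [hy, ← Finset.sum_mul] at hP'
  rwa [mul_inv_eq_one₀ (by positivity)] at hP'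

theorem lower_bound {d : ℕ} (hd : 1 ≤ d) (hn : d ^ 2 ≤ n * min (2 ^ k) d)
    (P : BlackboardProtocol n k (Fin (d + 1)))
    (est : (Fin (n * k) → Bool) → EuclideanSpace ℝ (Fin (d + 1))) :
    1 / 400 * max ((d : ℝ) / ((n : ℝ) * 2 ^ k)) (1 / (n : ℝ)) ≤ worstCaseRisk P.condProb est :=
  lower_bound_of_product_form (h := P.nodeProb) hd hn P.condProb P.condProb_eq_prod_nodeProb
    P.nodeProb_nonneg P.nodeProb_le_one
    (fun x => by simpa only [← P.condProb_eq_prod_nodeProb] using P.sum_condProb x)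
    (fun i x => (P.sum_prod_erase_nodeProb x i).le) est

end BlackboardProtocol

theorem mainTheorem6 :
    ∃ C : ℝ, 0 < C ∧ ∀ n k d : ℕ, 1 ≤ d → d ^ 2 ≤ n * min (2 ^ k) d →
      (∀ (P : IndProtocol n k (Fin (d + 1)))
          (est : (Fin n → Fin (2 ^ k)) → EuclideanSpace ℝ (Fin (d + 1))),
        C * max ((d : ℝ) / ((n : ℝ) * 2 ^ k)) (1 / (n : ℝ)) ≤ worstCaseRisk P.condProb est) ∧
      (∀ (P : SeqProtocol n k (Fin (d + 1)))
          (est : (Fin n → Fin (2 ^ k)) → EuclideanSpace ℝ (Fin (d + 1))),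
        C * max ((d : ℝ) / ((n : ℝ) * 2 ^ k)) (1 / (n : ℝ)) ≤ worstCaseRisk P.condProb est) ∧
      (∀ (P : BlackboardProtocol n k (Fin (d + 1)))
          (est : (Fin (n * k) → Bool) → EuclideanSpace ℝ (Fin (d + 1))),
        C * max ((d : ℝ) / ((n : ℝ) * 2 ^ k)) (1 / (n : ℝ)) ≤ worstCaseRisk P.condProb est) := by
  -- `P.toSeqProtocol.condProb` unfolds to `P.condProb`, so the sequential bound covers independent
  -- protocols as it stands.
  exact ⟨1 / 400, by norm_num, fun n k d hd hn =>
    ⟨fun P est => P.toSeqProtocol.lower_bound hd hn est, fun P est => P.lower_bound hd hn est,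
      fun P est => P.lower_bound hd hn est⟩⟩
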